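/- Let $\Bbbk$ be an algebraically closed field and let $A$ be a finite dimensional unital associative $\Bbbk$-algebra which is basic, i.e. all simple $A$-modules are one-dimensional over $\Bbbk$. Let $A\text{-}\mathrm{mod}$ be the category of finitely generated (equivalently, finite dimensional) left $A$-modules, and let $k>m\geq 1$ be integers. Let $\mathrm{F}$ be an additive $\Bbbk$-linear endofunctor of $A\text{-}\mathrm{mod}$ which is selfadjoint (i.e. adjoint to itself) and satisfies $\mathrm{F}^k\cong \mathrm{F}^m$, where $\mathrm{F}^n$ denotes the $n$-fold composition $\mathrm{F}\circ\cdots\circ\mathrm{F}$. (i) If $k-m$ is odd, then $\mathrm{F}^2\cong\mathrm{F}$. (Conversely, any endofunctor $\mathrm{G}$ of $A\text{-}\mathrm{mod}$ satisfying $\mathrm{G}^2\cong\mathrm{G}$ satisfies $\mathrm{G}^k\cong\mathrm{G}^m$.) (ii) If $k-m$ is even, then there are a decomposition $A\cong B\oplus C$ into a direct sum of $\Bbbk$-algebras (each unital or zero) and a $\Bbbk$-algebra automorphism $\varphi:B\to B$ such that $\varphi^2$ is inner (i.e. of the form $b\mapsto sbs^{-1}$ for some invertible $s\in B$) and $\mathrm{F}\cong\mathrm{F}_\varphi\boxplus\mathbf{0}$.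 Here $\mathrm{F}_\varphi={}_\varphi B\otimes_B{}_-:B\text{-}\mathrm{mod}\to B\text{-}\mathrm{mod}$, where ${}_\varphi B$ is the bimodule $B$ with actions $a\cdot x\cdot b=\varphi(a)xb$; $\mathbf{0}$ is the zero endofunctor of $C\text{-}\mathrm{mod}$; and $\mathrm{F}_\varphi\boxplus\mathbf{0}$ is the endofunctor of $A\text{-}\mathrm{mod}\simeq B\text{-}\mathrm{mod}\oplus C\text{-}\mathrm{mod}$ acting componentwise by $\mathrm{F}_\varphi$ and $\mathbf{0}$. -/

import Mathlib

universe v u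

open CategoryTheory
open scoped TensorProduct

noncomputable section

namespace SelfadjointFunctors

/-- A finite dimensional algebra over `k` (algebraically closed in the application) is basic if all
its simple left modules are one-dimensional over `k`. -/
def IsBasicAlgebra (k : Type v) (A : Type u) [Field k] [Ring A] [Algebra k A] : Prop :=
  ∀ (L : Type u) [AddCommGroup L] [Module k L] [Module A L] [IsScalarTower k A L],
    IsSimpleModule A L → Module.finrank k L = 1

/-- The composition power `F^n = F ∘ F ∘ ⋯ ∘ F` of an endofunctor. -/
def functorPow {C : Type*} [Category C] (F : C ⥤ C) : ℕ → (C ⥤ C)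
  | 0 => 𝟭 C
  | n + 1 => functorPow F n ⋙ F

/-- `F` is selfadjoint: it is left (equivalently right) adjoint to itself. -/
def IsSelfadjointFunctor {C : Type*} [Category C] (F : C ⥤ C) : Prop :=
  Nonempty (F ⊣ F)

/-! ### Tensor product of a bimodule with a left module over a noncommutative ring -/

section Tensor

variable (R S : Type*) [Ring R] [Ring S]
variable (X : Type*) [AddCommGroup X] [Module S X] [Module Rᵐᵒᵖ X]
variable (M : Type*) [AddCommGroup M] [Module R M]

/-- The relations `(x r) ⊗ m - x ⊗ (r m)`. (When the left `S`- and the right `R`-action on `X`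
commute, the set of these elements is stable under `S`, so that its `S`-span is its additive
span.) -/
def balancedRelations : Submodule S (X ⊗[ℤ] M) :=
  Submodule.span S {t | ∃ (x : X) (r : R) (m : M),
    t = (MulOpposite.op r • x) ⊗ₜ[ℤ] m - x ⊗ₜ[ℤ] (r • m)}

/-- The left `S`-module `X ⊗_R M`, for an `S`-`R`-bimodule `X` and a left `R`-module `M`. -/
abbrev BalancedTensor [SMulCommClass S Rᵐᵒᵖ X] : Type _ :=
  (X ⊗[ℤ] M) ⧸ balancedRelations R S X M

variable {M} {N : Type*} [AddCommGroup N] [Module R N]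

/-- The map `X ⊗ M → X ⊗ N` over `ℤ` induced by `f : M → N`, as an `S`-linear map. -/
def preTensorMap (f : M →ₗ[R] N) : X ⊗[ℤ] M →ₗ[S] X ⊗[ℤ] N :=
  TensorProduct.AlgebraTensorModule.map (LinearMap.id : X →ₗ[S] X) (f.restrictScalars ℤ)

theorem preTensorMap_tmul (f : M →ₗ[R] N) (x : X) (m : M) :
    preTensorMap R S X f (x ⊗ₜ[ℤ] m) = x ⊗ₜ[ℤ] f m := rfl

theorem balancedRelations_le_comap (f : M →ₗ[R] N) :
    balancedRelations R S X M ≤ (balancedRelations R S X N).comap (preTensorMap R S X f) := by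
  refine Submodule.span_le.2 ?_
  rintro _ ⟨x, r, m, rfl⟩
  refine Submodule.subset_span ⟨x, r, f m, ?_⟩
  rw [map_sub, preTensorMap_tmul, preTensorMap_tmul, map_smul]

/-- The map `X ⊗_R f : X ⊗_R M → X ⊗_R N`. -/
def balancedTensorMap [SMulCommClass S Rᵐᵒᵖ X] (f : M →ₗ[R] N) :
    BalancedTensor R S X M →ₗ[S] BalancedTensor R S X N :=
  Submodule.mapQ _ _ (preTensorMap R S X f) (balancedRelations_le_comap R S X f)

end Tensor

/-! ### The functor `F_φ` -/

section Twist

variable {k : Type v} [Field k] {B : Type u} [Ring B] [Algebra k B]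

/-- The bimodule `B` with left action twisted by `φ`, i.e. `a · x · b = φ(a) x b`. -/
def TwistedBimodule (_φ : B ≃ₐ[k] B) : Type u := B

variable (φ : B ≃ₐ[k] B)

instance : AddCommGroup (TwistedBimodule φ) := inferInstanceAs (AddCommGroup B)

instance : Module Bᵐᵒᵖ (TwistedBimodule φ) := inferInstanceAs (Module Bᵐᵒᵖ B)

instance : Module B (TwistedBimodule φ) := Module.compHom B (φ : B →+* B)

theorem TwistedBimodule.smul_def (a x : B) :
    (a • (show TwistedBimodule φ from x) : TwistedBimodule φ) = (φ a * x : B) := rfl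

theorem TwistedBimodule.op_smul_def (b x : B) :
    (MulOpposite.op b • (show TwistedBimodule φ from x) : TwistedBimodule φ) = (x * b : B) := rfl

instance : SMulCommClass B Bᵐᵒᵖ (TwistedBimodule φ) where
  smul_comm a b x := (mul_assoc (φ a) (show B from x) b.unop).symm

/-- If `M` is finitely generated, then so is the twisted bimodule tensored with `M`. -/
instance (M : Type u) [AddCommGroup M] [Module B M] [Module.Finite B M] :
    Module.Finite B (BalancedTensor B B (TwistedBimodule φ) M) := by
  let one : TwistedBimodule φ := (1 : B)
  let q := (balancedRelations B B (TwistedBimodule φ) M).mkQ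
  have key : ∀ (x : TwistedBimodule φ) (m : M),
      q (x ⊗ₜ[ℤ] m) = q (one ⊗ₜ[ℤ] ((show B from x) • m)) := by
    intro x m
    rw [← sub_eq_zero, ← map_sub]
    refine (Submodule.Quotient.mk_eq_zero _).2 (Submodule.subset_span ⟨one, x, m, ?_⟩)
    have h : MulOpposite.op (show B from x) • one = x := one_mul (show B from x)
    rw [h]
  obtain ⟨s, hs⟩ := (Module.Finite.fg_top : (⊤ : Submodule B M).FG)
  classical
  refine ⟨⟨s.image fun m => q (one ⊗ₜ[ℤ] m), ?_⟩⟩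
  have h1 : ∀ m : M, q (one ⊗ₜ[ℤ] m) ∈
      Submodule.span B (↑(s.image fun m => q (one ⊗ₜ[ℤ] m)) :
        Set (BalancedTensor B B (TwistedBimodule φ) M)) := by
    intro m
    have hm : m ∈ Submodule.span B (s : Set M) := by rw [hs]; trivial
    induction hm using Submodule.span_induction with
    | mem x hx => exact Submodule.subset_span (by
        rw [Finset.coe_image]; exact ⟨x, hx, rfl⟩)
    | zero => rw [TensorProduct.tmul_zero, map_zero]; exact Submodule.zero_mem _
    | add x y _ _ hx hy => rw [TensorProduct.tmul_add, map_add]; exact Submodule.add_mem _ hx hy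
    | smul b x _ hx =>
      have h2 : (φ.symm b • one : TwistedBimodule φ) = b := by
        change φ (φ.symm b) * 1 = b
        rw [mul_one, AlgEquiv.apply_symm_apply]
      have h3 : q (one ⊗ₜ[ℤ] (b • x)) = φ.symm b • q (one ⊗ₜ[ℤ] x) := by
        rw [← map_smul, TensorProduct.smul_tmul', h2]
        exact (key b x).symm
      rw [h3]
      exact Submodule.smul_mem _ _ hx
  rw [eq_top_iff]
  rintro y -
  obtain ⟨t, rfl⟩ := (balancedRelations B B (TwistedBimodule φ) M).mkQ_surjective y
  induction t using TensorProduct.induction_on with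
  | zero => rw [map_zero]; exact Submodule.zero_mem _
  | tmul x m => rw [show _ = _ from key x m]; exact h1 _
  | add x y hx hy => rw [map_add]; exact Submodule.add_mem _ hx hy

/-- The endofunctor `F_φ`, tensoring over `B` with the bimodule `B` twisted by `φ` on the left,
of the category of finitely generated `B`-modules. -/
def twistFunctor : FGModuleCat.{u} B ⥤ FGModuleCat.{u} B where
  obj M := FGModuleCat.of B (BalancedTensor B B (TwistedBimodule φ) M)
  map f := FGModuleCat.ofHom (balancedTensorMap B B (TwistedBimodule φ) f.hom.hom)
  map_id M := by
    ext : 1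
    refine Submodule.linearMap_qext _ (TensorProduct.AlgebraTensorModule.ext fun x m => rfl)
  map_comp f g := by
    ext : 1
    refine Submodule.linearMap_qext _ (TensorProduct.AlgebraTensorModule.ext fun x m => rfl)

end Twist

/-- An automorphism of the form `b ↦ s b s⁻¹` for an invertible `s`. -/
def IsInnerAut {k : Type v} [Field k] {B : Type u} [Ring B] [Algebra k B]
    (φ : B ≃ₐ[k] B) : Prop :=
  ∃ s : Bˣ, ∀ b : B, φ b = s * b * (s⁻¹ : Bˣ)

/-! ### External direct sums -/

/-- Restriction of scalars along a surjective ring homomorphism, on finitely generated modules. -/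
def restrictFG {R S : Type u} [Ring R] [Ring S] (f : R →+* S) (hf : Function.Surjective f) :
    FGModuleCat.{u} S ⥤ FGModuleCat.{u} R where
  obj M := ⟨(ModuleCat.restrictScalars.{u} f).obj M.obj, by
    let _ : Module R M := Module.compHom M f
    obtain ⟨s, hs⟩ := (Module.Finite.fg_top : (⊤ : Submodule S M).FG)
    refine ⟨⟨s, ?_⟩⟩
    rw [eq_top_iff]
    rintro (m : M) -
    have hm : m ∈ Submodule.span S (s : Set M) := by rw [hs]; trivial
    induction hm using Submodule.span_induction with
    | mem x hx => exact Submodule.subset_span hx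
    | zero => exact Submodule.zero_mem _
    | add x y _ _ hx hy => exact Submodule.add_mem _ hx hy
    | smul b x _ hx =>
      obtain ⟨r, rfl⟩ := hf b
      exact Submodule.smul_mem _ r hx⟩
  map g := ObjectProperty.homMk ((ModuleCat.restrictScalars.{u} f).map g.hom)

section ExternalSum

variable {B C : Type u} [Ring B] [Ring C]

/-- The `B`-component `(1, 0) M` of a module `M` over `B × C`. -/
def FstPart (M : Type u) [AddCommGroup M] [Module (B × C) M] : AddSubgroup M where
  carrier := {m | ((1, 0) : B × C) • m = m}
  zero_mem' := smul_zero _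
  add_mem' {x y} (hx : _ = _) (hy : _ = _) := by
    change _ • (x + y) = x + y
    rw [smul_add, hx, hy]
  neg_mem' {x} (hx : _ = _) := by
    change _ • (-x) = -x
    rw [smul_neg, hx]

/-- The `C`-component `(0, 1) M` of a module `M` over `B × C`. -/
def SndPart (M : Type u) [AddCommGroup M] [Module (B × C) M] : AddSubgroup M where
  carrier := {m | ((0, 1) : B × C) • m = m}
  zero_mem' := smul_zero _
  add_mem' {x y} (hx : _ = _) (hy : _ = _) := by
    change _ • (x + y) = x + y
    rw [smul_add, hx, hy]
  neg_mem' {x} (hx : _ = _) := by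
    change _ • (-x) = -x
    rw [smul_neg, hx]

section Parts

variable (M : Type u) [AddCommGroup M] [Module (B × C) M]

/-- `b ∈ B` acts on the `B`-component as `(b, 0)`. -/
instance : Module B (FstPart (B := B) (C := C) M) where
  smul b m := ⟨((b, 0) : B × C) • (m : M), by
    change ((1, 0) : B × C) • ((b, 0) : B × C) • (m : M) = ((b, 0) : B × C) • (m : M)
    rw [smul_smul]; simp⟩
  one_smul m := Subtype.ext m.2
  mul_smul a b m := Subtype.ext (by
    change ((a * b, 0) : B × C) • (m : M) = ((a, 0) : B × C) • ((b, 0) : B × C) • (m : M)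
    rw [smul_smul]; simp)
  smul_zero b := Subtype.ext (smul_zero _)
  smul_add b x y := Subtype.ext (smul_add _ _ _)
  add_smul a b m := Subtype.ext (by
    change ((a + b, 0) : B × C) • (m : M) = ((a, 0) : B × C) • (m : M) + ((b, 0) : B × C) • (m : M)
    rw [← add_smul]; simp)
  zero_smul m := Subtype.ext (zero_smul (B × C) (m : M))

/-- `c ∈ C` acts on the `C`-component as `(0, c)`. -/
instance : Module C (SndPart (B := B) (C := C) M) where
  smul b m := ⟨((0, b) : B × C) • (m : M), by
    change ((0, 1) : B × C) • ((0, b) : B × C) • (m : M) = ((0, b) : B × C) • (m : M)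
    rw [smul_smul]; simp⟩
  one_smul m := Subtype.ext m.2
  mul_smul a b m := Subtype.ext (by
    change ((0, a * b) : B × C) • (m : M) = ((0, a) : B × C) • ((0, b) : B × C) • (m : M)
    rw [smul_smul]; simp)
  smul_zero b := Subtype.ext (smul_zero _)
  smul_add b x y := Subtype.ext (smul_add _ _ _)
  add_smul a b m := Subtype.ext (by
    change ((0, a + b) : B × C) • (m : M) = ((0, a) : B × C) • (m : M) + ((0, b) : B × C) • (m : M)
    rw [← add_smul]; simp)
  zero_smul m := Subtype.ext (zero_smul (B × C) (m : M))

/-- Multiplication by `(1, 0)` as a map onto the `B`-component. -/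
def toFstPart : M →ₛₗ[RingHom.fst B C] FstPart (B := B) (C := C) M where
  toFun m := ⟨((1, 0) : B × C) • m, by
    change ((1, 0) : B × C) • ((1, 0) : B × C) • m = ((1, 0) : B × C) • m
    rw [smul_smul]; simp⟩
  map_add' x y := Subtype.ext (smul_add _ _ _)
  map_smul' r m := Subtype.ext (by
    change ((1, 0) : B × C) • r • m = ((r.1, 0) : B × C) • ((1, 0) : B × C) • m
    rw [smul_smul, smul_smul]; congr 1; ext <;> simp)

/-- Multiplication by `(0, 1)` as a map onto the `C`-component. -/
def toSndPart : M →ₛₗ[RingHom.snd B C] SndPart (B := B) (C := C) M where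
  toFun m := ⟨((0, 1) : B × C) • m, by
    change ((0, 1) : B × C) • ((0, 1) : B × C) • m = ((0, 1) : B × C) • m
    rw [smul_smul]; simp⟩
  map_add' x y := Subtype.ext (smul_add _ _ _)
  map_smul' r m := Subtype.ext (by
    change ((0, 1) : B × C) • r • m = ((0, r.2) : B × C) • ((0, 1) : B × C) • m
    rw [smul_smul, smul_smul]; congr 1; ext <;> simp)

instance [Module.Finite (B × C) M] : Module.Finite B (FstPart (B := B) (C := C) M) :=
  haveI : RingHomSurjective (RingHom.fst B C) := ⟨Prod.fst_surjective⟩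
  Module.Finite.of_surjective (toFstPart M) fun m => ⟨m, Subtype.ext m.2⟩

instance [Module.Finite (B × C) M] : Module.Finite C (SndPart (B := B) (C := C) M) :=
  haveI : RingHomSurjective (RingHom.snd B C) := ⟨Prod.snd_surjective⟩
  Module.Finite.of_surjective (toSndPart M) fun m => ⟨m, Subtype.ext m.2⟩

variable {M} {N : Type u} [AddCommGroup N] [Module (B × C) N]

/-- The restriction of a homomorphism to the `B`-components. -/
def fstPartMap (f : M →ₗ[B × C] N) :
    FstPart (B := B) (C := C) M →ₗ[B] FstPart (B := B) (C := C) N where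
  toFun m := ⟨f m, by
    change ((1, 0) : B × C) • f m = f m
    rw [← map_smul]; exact congrArg f m.2⟩
  map_add' x y := Subtype.ext (map_add f _ _)
  map_smul' b x := Subtype.ext (map_smul f _ _)

/-- The restriction of a homomorphism to the `C`-components. -/
def sndPartMap (f : M →ₗ[B × C] N) :
    SndPart (B := B) (C := C) M →ₗ[C] SndPart (B := B) (C := C) N where
  toFun m := ⟨f m, by
    change ((0, 1) : B × C) • f m = f m
    rw [← map_smul]; exact congrArg f m.2⟩
  map_add' x y := Subtype.ext (map_add f _ _)
  map_smul' b x := Subtype.ext (map_smul f _ _)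

end Parts

variable (B C) in
/-- The functor `M ↦ (1, 0) M` from `B × C`-modules to `B`-modules. -/
def fstFunctor : FGModuleCat.{u} (B × C) ⥤ FGModuleCat.{u} B where
  obj M := FGModuleCat.of B (FstPart (B := B) (C := C) M)
  map f := FGModuleCat.ofHom (fstPartMap f.hom.hom)

variable (B C) in
/-- The functor `M ↦ (0, 1) M` from `B × C`-modules to `C`-modules. -/
def sndFunctor : FGModuleCat.{u} (B × C) ⥤ FGModuleCat.{u} C where
  obj M := FGModuleCat.of C (SndPart (B := B) (C := C) M)
  map f := FGModuleCat.ofHom (sndPartMap f.hom.hom)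

/-- The external direct sum `F₁ ⊞ F₂`, acting componentwise on modules over `B × C`: it sends `M`,
with components `M₁` and `M₂`, to `F₁ M₁ × F₂ M₂`, on which `B × C` acts componentwise. -/
def externalSum (F₁ : FGModuleCat.{u} B ⥤ FGModuleCat.{u} B)
    (F₂ : FGModuleCat.{u} C ⥤ FGModuleCat.{u} C) :
    FGModuleCat.{u} (B × C) ⥤ FGModuleCat.{u} (B × C) :=
  let G₁ := fstFunctor B C ⋙ F₁ ⋙ restrictFG (RingHom.fst B C) Prod.fst_surjective
  let G₂ := sndFunctor B C ⋙ F₂ ⋙ restrictFG (RingHom.snd B C) Prod.snd_surjective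
  { obj := fun M => FGModuleCat.of (B × C) (G₁.obj M × G₂.obj M)
    map := fun f => FGModuleCat.ofHom (LinearMap.prodMap (G₁.map f).hom.hom (G₂.map f).hom.hom)
    map_id := fun M => by
      rw [G₁.map_id, G₂.map_id]; rfl
    map_comp := fun f g => by
      rw [G₁.map_comp, G₂.map_comp]; rfl }

end ExternalSum

/-- The zero endofunctor: every module is sent to the zero module. -/
def zeroFunctor (C : Type u) [Ring C] : FGModuleCat.{u} C ⥤ FGModuleCat.{u} C :=
  (Functor.const _).obj (FGModuleCat.of C PUnit.{u + 1})

/-- Transport of an endofunctor of `S`-modules to `R`-modules along a ring isomorphism `R ≃ S`. -/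
def transportFunctor {R S : Type u} [Ring R] [Ring S] (e : R ≃+* S)
    (F : FGModuleCat.{u} S ⥤ FGModuleCat.{u} S) : FGModuleCat.{u} R ⥤ FGModuleCat.{u} R :=
  restrictFG (e.symm : S →+* R) e.symm.surjective ⋙ F ⋙ restrictFG (e : R →+* S) e.surjective

end SelfadjointFunctors

end

/-!
Let `ε : F² ⟶ 1` and `η : 1 ⟶ F²` be the counit and the unit of a selfadjunction of `F`. By the
triangle identities each positive power of `F` is a retract of all higher powers of the same
parity, and `Fᵏ ≅ Fᵐ` makes high powers retracts of lower ones. A surjective endomorphism of a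
Noetherian module is injective, so the counit is an isomorphism on a high power of `F`, hence on
its retract `F`. Therefore `F³ ≅ F`, which for odd `k - m` forces `F² ≅ F`.

Moreover `ε ≫ η` is then an isomorphism, so `ε` is a split monomorphism, and its retraction
followed by `ε` is multiplication by a central idempotent `e`: the functor `F²` is `M ↦ e M`. If
`A` is basic, `F` sends simple modules to simple modules or `0`, so by adjunction `F A` maps to
each simple module in at most one way up to scalars and is generated by a single `t`. By an
Eilenberg–Watts argument, `t` identifies `F M` with `e M`, on which `a` acts through `σ a` for an
endomorphism `σ` of `e A`. Comparing the resulting description of `F²` with the untwisted one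
shows that `σ²` is inner.
-/

noncomputable section

namespace SelfadjointFunctors

section Powers

variable {C : Type*} [Category* C] {F : C ⥤ C}

theorem functorPow_add_iso {a b : ℕ} (h : Nonempty (functorPow F a ≅ functorPow F b)) (n : ℕ) :
    Nonempty (functorPow F (a + n) ≅ functorPow F (b + n)) := by
  induction n with
  | zero => exact h
  | succ n ih => exact ih.map fun α => Functor.isoWhiskerRight α F

theorem functorPow_iso_of_idempotent (h : Nonempty (functorPow F 2 ≅ F)) {n : ℕ} (hn : 1 ≤ n) :
    Nonempty (functorPow F n ≅ F) := by
  obtain ⟨α⟩ := h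
  induction n, hn using Nat.le_induction with
  | base => exact ⟨F.leftUnitor⟩
  | succ n _ ih =>
    obtain ⟨β⟩ := ih
    exact ⟨Functor.isoWhiskerRight (β ≪≫ F.leftUnitor.symm) F ≪≫ α⟩

theorem functorPow_add_two_mul_iso (h : Nonempty (functorPow F 3 ≅ functorPow F 1)) (n j : ℕ) :
    Nonempty (functorPow F (n + 1 + 2 * j) ≅ functorPow F (n + 1)) := by
  induction j with
  | zero => exact ⟨Iso.refl _⟩
  | succ j ih =>
    obtain ⟨α⟩ := functorPow_add_iso h (n + 2 * j)
    obtain ⟨β⟩ := ih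
    rw [show 3 + (n + 2 * j) = n + 1 + 2 * (j + 1) by ring,
      show 1 + (n + 2 * j) = n + 1 + 2 * j by ring] at α
    exact ⟨α ≪≫ β⟩

theorem functorPow_two_iso_of_odd (h : Nonempty (functorPow F 3 ≅ functorPow F 1)) {m d : ℕ}
    (hd : Odd d) (hF : Nonempty (functorPow F (m + d) ≅ functorPow F m)) :
    Nonempty (functorPow F 2 ≅ F) := by
  obtain ⟨c, rfl⟩ := hd
  obtain ⟨α⟩ := functorPow_add_iso hF (m + 1)
  obtain ⟨even_iso⟩ := functorPow_add_two_mul_iso h 1 (m + c)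
  obtain ⟨odd_iso⟩ := functorPow_add_two_mul_iso h 0 m
  rw [show m + (2 * c + 1) + (m + 1) = 1 + 1 + 2 * (m + c) by ring,
    show m + (m + 1) = 0 + 1 + 2 * m by ring] at α
  exact ⟨even_iso.symm ≪≫ α ≪≫ odd_iso ≪≫ F.leftUnitor⟩

end Powers

section Selfadjoint

variable {C : Type*} [Category* C]

theorem isIso_retract_r {X Y : C} [IsDedekindFiniteMonoid (End Y)] (h : Retract X Y)
    (h' : Retract Y X) : IsIso h.r := by
  have split : (h'.i ≫ h.i) ≫ h.r ≫ h'.r = 𝟙 Y := by simp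
  have split' : (h.r ≫ h'.r) ≫ h'.i ≫ h.i = 𝟙 Y :=
    mul_eq_one_symm (M := End Y) (a := h.r ≫ h'.r) (b := h'.i ≫ h.i) split
  have : IsSplitMono h.r := .mk' ⟨h'.r ≫ h'.i ≫ h.i, by simpa using split'⟩
  have : IsSplitEpi h.r := .mk' ⟨h.i, h.retract⟩
  exact isIso_of_mono_of_isSplitEpi h.r

variable {F : C ⥤ C} (adj : F ⊣ F)

/-- The first triangle identity of a selfadjunction, as a retraction of `F³ X` onto `F X`. -/
def counitRetract (X : C) : Retract (F.obj X) (F.obj (F.obj (F.obj X))) where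
  i := F.map (adj.unit.app X)
  r := adj.counit.app (F.obj X)
  retract := adj.left_triangle_components X

/-- The counit exhibits a positive power of a selfadjoint functor as a retract of all higher powers
of the same parity. -/
def functorPowRetract (X : C) (n : ℕ) : (j : ℕ) →
    Retract ((functorPow F (n + 1)).obj X) ((functorPow F (n + 2 * j + 1)).obj X)
  | 0 => .refl _
  | j + 1 => (functorPowRetract X n j).trans
      (counitRetract adj ((functorPow F (n + 2 * j)).obj X))

variable [∀ X : C, IsDedekindFiniteMonoid (End X)] {m d : ℕ}

include adj

theorem isIso_counit_app_functorPow (hd : 1 ≤ d)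
    (hF : Nonempty (functorPow F (m + d) ≅ functorPow F m)) (X : C) :
    IsIso (adj.counit.app ((functorPow F (2 * m + 1)).obj X)) := by
  obtain ⟨α⟩ := functorPow_add_iso hF (m + d + 1)
  obtain ⟨β⟩ := functorPow_add_iso hF (m + 1)
  obtain ⟨c, rfl⟩ := Nat.exists_eq_add_of_le' hd
  rw [show m + (c + 1) + (m + (c + 1) + 1) = 2 * m + 2 + 2 * c + 1 by ring] at α
  rw [show m + (c + 1) + (m + 1) = m + (m + (c + 1) + 1) by ring,
    show m + (m + 1) = 2 * m + 1 by ring] at β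
  exact isIso_retract_r (counitRetract adj ((functorPow F (2 * m)).obj X))
    ((functorPowRetract adj X (2 * m + 2) c).trans (.ofIso ((α ≪≫ β).app X)))

theorem isIso_counit_app_obj (hd : 1 ≤ d)
    (hF : Nonempty (functorPow F (m + d) ≅ functorPow F m)) (X : C) :
    IsIso (adj.counit.app (F.obj X)) := by
  have retract := functorPowRetract adj X 0 m
  rw [Nat.zero_add (2 * m)] at retract
  exact (MorphismProperty.isomorphisms C).of_retract
    (NatTrans.retractArrowApp adj.counit (X := F.obj X) retract)
    (isIso_counit_app_functorPow adj hd hF X)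

omit [∀ X : C, IsDedekindFiniteMonoid (End X)]

variable [∀ X, IsIso (adj.counit.app (F.obj X))]

theorem functorPow_three_iso : Nonempty (functorPow F 3 ≅ functorPow F 1) :=
  have (X : C) : IsIso ((F.whiskerLeft adj.counit).app X) :=
    inferInstanceAs (IsIso (adj.counit.app (F.obj X)))
  ⟨@asIso _ _ _ _ _ (NatIso.isIso_of_isIso_app (F.whiskerLeft adj.counit))⟩

theorem isIso_map_unit_app (X : C) : IsIso (F.map (adj.unit.app X)) := by
  rw [show F.map (adj.unit.app X) = inv (adj.counit.app (F.obj X)) from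
    IsIso.eq_inv_of_inv_hom_id (adj.left_triangle_components X)]
  infer_instance

theorem map_map_counit_app (X : C) :
    F.map (F.map (adj.counit.app X)) = adj.counit.app (F.obj (F.obj X)) := by
  have := isIso_map_unit_app adj (F.obj X)
  have map_triangle : F.map (adj.unit.app (F.obj X)) ≫ F.map (F.map (adj.counit.app X)) = 𝟙 _ := by
    rw [← F.map_comp, adj.right_triangle_components]
    exact F.map_id _
  exact (cancel_epi (F.map (adj.unit.app (F.obj X)))).1
    (map_triangle.trans (adj.left_triangle_components (F.obj X)).symm)

theorem isIso_unit_app_obj_obj (X : C) : IsIso (adj.unit.app (F.obj (F.obj X))) := by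
  rw [show adj.unit.app (F.obj (F.obj X)) = inv (F.map (adj.counit.app (F.obj X))) from
    IsIso.eq_inv_of_inv_hom_id (adj.right_triangle_components (F.obj X))]
  infer_instance

theorem isIso_counit_app_comp_unit_app (X : C) :
    IsIso (adj.counit.app X ≫ adj.unit.app X) := by
  have := isIso_unit_app_obj_obj adj X
  have naturality : adj.counit.app X ≫ adj.unit.app X =
      adj.unit.app (F.obj (F.obj X)) ≫ F.map (F.map (adj.counit.app X)) :=
    adj.unit.naturality (adj.counit.app X)
  rw [naturality, map_map_counit_app]
  infer_instance

theorem isSplitMono_counit : IsSplitMono adj.counit :=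
  have (X : C) : IsIso ((adj.counit ≫ adj.unit).app X) := isIso_counit_app_comp_unit_app adj X
  have := NatIso.isIso_of_isIso_app (adj.counit ≫ adj.unit)
  .mk' ⟨adj.unit ≫ inv (adj.counit ≫ adj.unit), by
    rw [← Category.assoc, IsIso.hom_inv_id]⟩

end Selfadjoint

section Modules

variable {A : Type u} [Ring A] {X Y Z : FGModuleCat.{u} A}

theorem hom_comp_apply (f : X ⟶ Y) (g : Y ⟶ Z) (x : X) :
    (f ≫ g).hom.hom x = g.hom.hom (f.hom.hom x) := rfl

theorem surjective_of_epi (f : X ⟶ Y) [Epi f] : Function.Surjective f.hom.hom :=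
  (ModuleCat.epi_iff_surjective f.hom).1
    (inferInstanceAs (Epi ((forget₂ (FGModuleCat A) (ModuleCat A)).map f)))

theorem injective_of_mono [IsNoetherianRing A] (f : X ⟶ Y) [Mono f] :
    Function.Injective f.hom.hom :=
  (ModuleCat.mono_iff_injective f.hom).1
    (inferInstanceAs (Mono ((forget₂ (FGModuleCat A) (ModuleCat A)).map f)))

instance isDedekindFiniteMonoid_end [IsNoetherianRing A] (X : FGModuleCat.{u} A) :
    IsDedekindFiniteMonoid (End X) where
  mul_eq_one_symm {f g} hfg := by
    have f_g (x : X) : f.hom.hom (g.hom.hom x) = x := congrArg (fun h => h.hom.hom x) hfg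
    have injective : Function.Injective f.hom.hom :=
      IsNoetherian.injective_of_surjective_endomorphism _ fun x => ⟨g.hom.hom x, f_g x⟩
    exact FGModuleCat.hom_ext (LinearMap.ext fun x => injective (f_g (f.hom.hom x)))

/-- The morphism `a ↦ a • x` from the regular module. -/
def evalHom (x : X) : FGModuleCat.of A A ⟶ X :=
  FGModuleCat.ofHom (LinearMap.toSpanSingleton A X x)

theorem evalHom_apply (x : X) (a : A) : (evalHom x).hom.hom a = a • x := rfl

theorem evalHom_comp (x : X) (f : X ⟶ Y) : evalHom x ≫ f = evalHom (f.hom.hom x) :=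
  FGModuleCat.hom_ext (LinearMap.ext fun a => map_smul f.hom.hom a x)

theorem evalHom_one (f : FGModuleCat.of A A ⟶ X) : evalHom (f.hom.hom (1 : A)) = f := by
  refine FGModuleCat.hom_ext (LinearMap.ext fun a => ?_)
  rw [evalHom_apply, ← map_smul, smul_eq_mul, mul_one]

theorem evalHom_add (x y : X) : evalHom (x + y) = evalHom x + evalHom y :=
  FGModuleCat.hom_ext (LinearMap.ext fun a => smul_add a x y)

open scoped ModuleCat.Algebra in
theorem evalHom_algebra_smul {k : Type v} [Field k] [Algebra k A] (r : k) (x : X) :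
    evalHom (r • x) = r • evalHom x :=
  FGModuleCat.hom_ext (LinearMap.ext fun a => smul_comm a r x)

theorem exists_commute_app_eq_smul (τ : 𝟭 (FGModuleCat.{u} A) ⟶ 𝟭 (FGModuleCat.{u} A)) :
    ∃ e : A, (∀ a, Commute e a) ∧
      ∀ (X : FGModuleCat.{u} A) (x : X), (τ.app X).hom.hom x = e • x := by
  have app_eq (X : FGModuleCat.{u} A) (x : X) :
      (τ.app X).hom.hom x = (τ.app (FGModuleCat.of A A)).hom.hom (1 : A) • x := by
    have naturality := congrArg (fun f => f.hom.hom (1 : A)) (τ.naturality (evalHom x))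
    change (τ.app X).hom.hom ((1 : A) • x) = _ at naturality
    rwa [one_smul] at naturality
  refine ⟨(τ.app (FGModuleCat.of A A)).hom.hom (1 : A), fun a => ?_, app_eq⟩
  have linear : (τ.app (FGModuleCat.of A A)).hom.hom (a * 1) = a * _ :=
    map_smul (τ.app (FGModuleCat.of A A)).hom.hom a (1 : A)
  rw [mul_one] at linear
  exact (app_eq (FGModuleCat.of A A) a).symm.trans linear

end Modules

section CounitIdempotent

variable {A : Type u} [Ring A] {F : FGModuleCat.{u} A ⥤ FGModuleCat.{u} A} (adj : F ⊣ F)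

/-- The counit of a selfadjunction at `X`, as a linear map. -/
abbrev counitMap (X : FGModuleCat.{u} A) : F.obj (F.obj X) →ₗ[A] X :=
  (adj.counit.app X).hom.hom

theorem counitMap_naturality {X Y : FGModuleCat.{u} A} (f : X ⟶ Y) (y : F.obj (F.obj X)) :
    counitMap adj Y ((F.map (F.map f)).hom.hom y) = f.hom.hom (counitMap adj X y) :=
  congrArg (fun g => g.hom.hom y) (adj.counit.naturality f)

/-- `e` is a central idempotent projecting every module onto the image of the counit, which is
injective, and acting as the identity on the image of the functor `F`. -/
structure IsCounitIdempotent (e : A) : Prop where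
  commute (a : A) : Commute e a
  isIdempotentElem : IsIdempotentElem e
  injective (X : FGModuleCat.{u} A) : Function.Injective (counitMap adj X)
  smul_eq_iff {X : FGModuleCat.{u} A} (x : X) : e • x = x ↔ ∃ y, counitMap adj X y = x
  smul_obj {X : FGModuleCat.{u} A} (y : F.obj X) : e • y = y

theorem exists_isCounitIdempotent [IsNoetherianRing A] [IsSplitMono adj.counit]
    [∀ X, IsIso (adj.counit.app (F.obj X))] : ∃ e, IsCounitIdempotent adj e := by
  obtain ⟨e, commute, app_eq⟩ := exists_commute_app_eq_smul (retraction adj.counit ≫ adj.counit)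
  have smul_eq_iff (X : FGModuleCat.{u} A) (x : X) :
      e • x = x ↔ ∃ y, counitMap adj X y = x := by
    rw [← app_eq]
    refine ⟨fun h => ⟨((retraction adj.counit).app X).hom.hom x, h⟩, ?_⟩
    rintro ⟨y, rfl⟩
    exact congrArg (fun g => (adj.counit.app X).hom.hom ((g.app X).hom.hom y))
      (IsSplitMono.id adj.counit)
  refine ⟨e, commute, ?_, fun X => injective_of_mono (adj.counit.app X),
    fun {X} => smul_eq_iff X, fun {X} y => ?_⟩
  · refine (smul_eq_iff (FGModuleCat.of A A) e).2
      ⟨((retraction adj.counit).app (FGModuleCat.of A A)).hom.hom (1 : A), ?_⟩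
    exact (app_eq (FGModuleCat.of A A) (1 : A)).trans (mul_one e)
  · exact (smul_eq_iff (F.obj X) y).2 (surjective_of_epi (adj.counit.app (F.obj X)) y)

end CounitIdempotent

section CornerTwist

variable (k : Type v) {A : Type u} [Field k] [Ring A] [Algebra k A]

/-- A description of `F` as the functor sending `M` to its corner `e M`, for a central idempotent
`e`, with `a` acting on it as `twist a` does on `M`; the corner is given by the embedding
`emb M : F M → M` with image `e M`. -/
structure CornerTwist (F : FGModuleCat.{u} A ⥤ FGModuleCat.{u} A) (e : A) where
  commute (a : A) : Commute e a
  isIdempotentElem : IsIdempotentElem e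
  twist : A →ₙₐ[k] A
  emb (M : FGModuleCat.{u} A) : F.obj M →+ M
  twist_mul_self (a : A) : twist a * e = twist a
  emb_smul {M : FGModuleCat.{u} A} (a : A) (x : F.obj M) : emb M (a • x) = twist a • emb M x
  emb_map {M N : FGModuleCat.{u} A} (f : M ⟶ N) (x : F.obj M) :
    emb N ((F.map f).hom.hom x) = f.hom.hom (emb M x)
  emb_injective (M : FGModuleCat.{u} A) : Function.Injective (emb M)
  smul_eq_iff {M : FGModuleCat.{u} A} (m : M) : e • m = m ↔ ∃ x, emb M x = m
  smul_obj {M : FGModuleCat.{u} A} (x : F.obj M) : e • x = x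

variable {k} {F : FGModuleCat.{u} A ⥤ FGModuleCat.{u} A} {e : A}

namespace CornerTwist

variable (D : CornerTwist k F e)

theorem smul_emb {M : FGModuleCat.{u} A} (x : F.obj M) : e • D.emb M x = D.emb M x :=
  (D.smul_eq_iff _).2 ⟨x, rfl⟩

include D in
theorem exists_emb_eq :
    ∃ u : F.obj (FGModuleCat.of A A), D.emb (FGModuleCat.of A A) u = e :=
  (D.smul_eq_iff (M := FGModuleCat.of A A) e).1 D.isIdempotentElem

theorem twist_self : D.twist e = e := by
  obtain ⟨u, hu⟩ := D.exists_emb_eq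
  have smul_u : D.emb (FGModuleCat.of A A) (e • u) = D.twist e * e :=
    (D.emb_smul e u).trans (congrArg (D.twist e * ·) hu)
  rw [← D.twist_mul_self, ← smul_u, D.smul_obj, hu]

theorem twist_mul (a : A) : D.twist (a * e) = D.twist a := by
  rw [map_mul, D.twist_self, D.twist_mul_self]

/-- Composing `F` with itself iterates the twist. -/
def comp : CornerTwist k (F ⋙ F) e where
  commute := D.commute
  isIdempotentElem := D.isIdempotentElem
  twist := D.twist.comp D.twist
  emb M := (D.emb M).comp (D.emb (F.obj M))
  twist_mul_self a := D.twist_mul_self _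
  emb_smul a x := (congrArg _ (D.emb_smul a x)).trans (D.emb_smul _ _)
  emb_map f x := (congrArg _ (D.emb_map (F.map f) x)).trans (D.emb_map f _)
  emb_injective M := (D.emb_injective M).comp (D.emb_injective (F.obj M))
  smul_eq_iff {M} m := by
    rw [D.smul_eq_iff]
    refine ⟨fun ⟨x, hx⟩ => ?_, fun ⟨y, hy⟩ => ⟨D.emb (F.obj M) y, hy⟩⟩
    obtain ⟨y, rfl⟩ := (D.smul_eq_iff x).1 (D.smul_obj x)
    exact ⟨y, hx⟩
  smul_obj x := D.smul_obj x

variable (D' : CornerTwist k F e)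

/- If `D.emb u = e`, then `F` maps `u` to `x` under the morphism `1 ↦ D.emb M x`; hence the value of
`D'.emb` at `u` determines all others. -/
theorem exists_emb_eq_smul :
    ∃ s, s * e = s ∧ ∀ (M : FGModuleCat.{u} A) (x : F.obj M), D'.emb M x = s • D.emb M x := by
  obtain ⟨u, hu⟩ := D.exists_emb_eq
  refine ⟨D'.emb (FGModuleCat.of A A) u, (D.commute _).symm.trans (D'.smul_emb u), fun M x => ?_⟩
  have map_u : (F.map (evalHom (D.emb M x))).hom.hom u = x := by
    apply D.emb_injective
    rw [D.emb_map, hu, evalHom_apply, D.smul_emb]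
  conv_lhs => rw [← map_u]
  rw [D'.emb_map, evalHom_apply]

theorem exists_mul_twist_eq :
    ∃ s s', s * s' = e ∧ ∀ a, s * D.twist a = D'.twist a * s := by
  obtain ⟨s, hse, hs⟩ := exists_emb_eq_smul D D'
  obtain ⟨s', hse', hs'⟩ := exists_emb_eq_smul D' D
  obtain ⟨u, hu⟩ := D.exists_emb_eq
  obtain ⟨u', hu'⟩ := D'.exists_emb_eq
  refine ⟨s, s', ?_, fun a => ?_⟩
  · have emb_u' := hs (FGModuleCat.of A A) u'
    rw [hs', hu'] at emb_u'
    calc s * s' = s * (s' * e) := by rw [hse']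
      _ = e := emb_u'.symm
  · have emb_smul_u := hs (FGModuleCat.of A A) (a • u)
    rw [D'.emb_smul, D.emb_smul, hs, hu] at emb_smul_u
    calc s * D.twist a = s * (D.twist a * e) := by rw [D.twist_mul_self]
      _ = D'.twist a * (s * e) := emb_smul_u.symm
      _ = D'.twist a * s := by rw [hse]

end CornerTwist

variable {adj : F ⊣ F}

/-- The counit identifies `F² M` with the corner `e M`, without a twist. -/
def IsCounitIdempotent.cornerTwist (h : IsCounitIdempotent adj e) : CornerTwist k (F ⋙ F) e where
  commute := h.commute
  isIdempotentElem := h.isIdempotentElem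
  twist :=
    { toFun a := a * e
      map_smul' r a := smul_mul_assoc r a e
      map_zero' := zero_mul e
      map_add' a b := add_mul a b e
      map_mul' a b := by
        rw [mul_assoc a e, ← mul_assoc e, (h.commute b).eq, mul_assoc b, h.isIdempotentElem,
          mul_assoc] }
  emb M := (counitMap adj M).toAddMonoidHom
  twist_mul_self a := (mul_assoc a e e).trans (congrArg (a * ·) h.isIdempotentElem)
  emb_smul {M} a x := by
    change counitMap adj M (a • x) = (a * e) • counitMap adj M x
    rw [map_smul, mul_smul, (h.smul_eq_iff _).2 ⟨x, rfl⟩]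
  emb_map f x := counitMap_naturality adj f x
  emb_injective M := h.injective M
  smul_eq_iff m := h.smul_eq_iff m
  smul_obj x := h.smul_obj x

theorem IsCounitIdempotent.exists_mul_eq_twist_twist_mul (h : IsCounitIdempotent adj e)
    (D : CornerTwist k F e) :
    ∃ s s', s * s' = e ∧ ∀ a, s * (a * e) = D.twist (D.twist a) * s :=
  (h.cornerTwist (k := k)).exists_mul_twist_eq D.comp

section Generator

variable {t : F.obj (FGModuleCat.of A A)}

theorem IsCounitIdempotent.isIso_counit_comp_evalHom [IsNoetherianRing A]
    (h : IsCounitIdempotent adj e) (ht : Submodule.span A {t} = ⊤) :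
    IsIso (adj.counit.app (FGModuleCat.of A A) ≫ evalHom t) := by
  have surjective : Function.Surjective (evalHom t).hom.hom := fun x =>
    Submodule.mem_span_singleton.1 (ht ▸ Submodule.mem_top)
  set f := adj.counit.app (FGModuleCat.of A A) ≫ evalHom t with hf
  have f_surjective : Function.Surjective f.hom.hom := fun x => by
    obtain ⟨a, rfl⟩ := surjective x
    obtain ⟨y, hy⟩ := (h.smul_eq_iff (X := FGModuleCat.of A A) (e * a)).1
      ((mul_assoc e e a).symm.trans (congrArg (· * a) h.isIdempotentElem))
    refine ⟨y, ?_⟩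
    rw [hf, hom_comp_apply, hy, evalHom_apply, evalHom_apply, mul_smul, h.smul_obj]
  have : Epi (evalHom t) := ConcreteCategory.epi_of_surjective _ surjective
  have := Functor.preservesEpimorphisms_of_adjunction adj
  let g := F.map (evalHom t)
  have g_surjective : Function.Surjective g.hom.hom := surjective_of_epi g
  have gf_injective : Function.Injective (f.hom.hom ∘ g.hom.hom) :=
    IsNoetherian.injective_of_surjective_endomorphism (g ≫ f).hom.hom
      (f_surjective.comp g_surjective)
  have := ConcreteCategory.mono_of_injective f (gf_injective.of_comp_right g_surjective)
  have := ConcreteCategory.epi_of_surjective f f_surjective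
  exact isIso_of_mono_of_epi f

theorem IsCounitIdempotent.exists_coordinate [IsNoetherianRing A]
    (h : IsCounitIdempotent adj e) (ht : Submodule.span A {t} = ⊤) :
    ∃ g : F.obj (FGModuleCat.of A A) →ₗ[A] A,
      g t = e ∧ (∀ x, e * g x = g x) ∧ ∀ x, g x • t = x := by
  have := h.isIso_counit_comp_evalHom ht
  let f := adj.counit.app (FGModuleCat.of A A) ≫ evalHom t
  have inv_f (y) : (inv f).hom.hom (f.hom.hom y) = y :=
    congrArg (fun g => g.hom.hom y) (IsIso.hom_inv_id f)
  have f_inv (x) : f.hom.hom ((inv f).hom.hom x) = x :=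
    congrArg (fun g => g.hom.hom x) (IsIso.inv_hom_id f)
  obtain ⟨y, hy⟩ := (h.smul_eq_iff (X := FGModuleCat.of A A) e).1 h.isIdempotentElem
  have f_y : f.hom.hom y = t := by
    rw [hom_comp_apply, hy, evalHom_apply, h.smul_obj]
  refine ⟨counitMap adj (FGModuleCat.of A A) ∘ₗ (inv f).hom.hom, ?_,
    fun x => (h.smul_eq_iff (X := FGModuleCat.of A A) _).2 ⟨(inv f).hom.hom x, rfl⟩, f_inv⟩
  rw [LinearMap.comp_apply, ← f_y, inv_f, hy]

/-- The additive map `X → F X` sending `x` to the image of `t` under `F` of the morphism `1 ↦ x`. -/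
def pushforward [F.Additive] (t : F.obj (FGModuleCat.of A A)) (X : FGModuleCat.{u} A) :
    X →+ F.obj X :=
  .mk' (fun x => (F.map (evalHom x)).hom.hom t) fun x y => by rw [evalHom_add, F.map_add]; rfl

variable [F.Additive]

theorem map_pushforward {X Y : FGModuleCat.{u} A} (f : X ⟶ Y) (x : X) :
    (F.map f).hom.hom (pushforward t X x) = pushforward t Y (f.hom.hom x) := by
  change (F.map (evalHom x) ≫ F.map f).hom.hom t = _
  rw [← F.map_comp, evalHom_comp]
  rfl

theorem pushforward_smul {X : FGModuleCat.{u} A} (a : A) (x : X) :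
    pushforward t X (a • x) =
      (F.map (evalHom x)).hom.hom (pushforward t (FGModuleCat.of A A) a) :=
  (map_pushforward (evalHom x) a).symm

open scoped ModuleCat.Algebra in
theorem pushforward_algebra_smul [F.Linear k] {X : FGModuleCat.{u} A} (r : k) (x : X) :
    pushforward t X (r • x) = r • pushforward t X x := by
  change (F.map (evalHom (r • x))).hom.hom t = _
  rw [evalHom_algebra_smul, F.map_smul]
  rfl

theorem counitMap_pushforward_injective (ht : Submodule.span A {t} = ⊤) (M : FGModuleCat.{u} A) :
    Function.Injective fun x : F.obj M => counitMap adj M (pushforward t (F.obj M) x) := by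
  intro x y hxy
  have hom_eq : (adj.homEquiv _ _).symm (evalHom x) = (adj.homEquiv _ _).symm (evalHom y) := by
    rw [adj.homEquiv_counit, adj.homEquiv_counit]
    exact FGModuleCat.hom_ext (LinearMap.ext_on ht (Set.eqOn_singleton.2 hxy))
  have eval_eq := congrArg (fun f => f.hom.hom (1 : A)) ((adj.homEquiv _ _).symm.injective hom_eq)
  rwa [evalHom_apply, evalHom_apply, one_smul, one_smul] at eval_eq

theorem exists_counitMap_pushforward_eq (g : F.obj (FGModuleCat.of A A) →ₗ[A] A)
    {M : FGModuleCat.{u} A} (m : M) :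
    ∃ x : F.obj M, counitMap adj M (pushforward t (F.obj M) x) = g t • m := by
  let f : F.obj (FGModuleCat.of A A) ⟶ M := FGModuleCat.ofHom g ≫ evalHom m
  refine ⟨(adj.homEquiv _ _ f).hom.hom (1 : A), ?_⟩
  have factorization : F.map (adj.homEquiv _ _ f) ≫ adj.counit.app M = f :=
    (adj.homEquiv_counit _ _ _).symm.trans (Equiv.symm_apply_apply _ f)
  rw [← evalHom_one (adj.homEquiv _ _ f)] at factorization
  exact congrArg (fun h => h.hom.hom t) factorization

theorem pushforward_smul_eq_smul {g : F.obj (FGModuleCat.of A A) →ₗ[A] A}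
    (hg : ∀ x, g x • t = x) {X : FGModuleCat.{u} A} (a : A) (x : X) :
    pushforward t X (a • x) = g (pushforward t (FGModuleCat.of A A) a) • pushforward t X x := by
  conv_lhs => rw [pushforward_smul, ← hg (pushforward t (FGModuleCat.of A A) a), map_smul]
  rfl

open scoped ModuleCat.Algebra in
/-- The corner twist defined by a generator `t` of `F A` and a section `g` of the surjection
`a ↦ a • t`. -/
def IsCounitIdempotent.cornerTwistOfGenerator [F.Linear k] (h : IsCounitIdempotent adj e)
    (ht : Submodule.span A {t} = ⊤) (g : F.obj (FGModuleCat.of A A) →ₗ[A] A) (g_t : g t = e)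
    (e_mul_g : ∀ x, e * g x = g x) (g_smul : ∀ x, g x • t = x) : CornerTwist k F e where
  commute := h.commute
  isIdempotentElem := h.isIdempotentElem
  twist :=
    { toFun a := g (pushforward t (FGModuleCat.of A A) a)
      map_smul' r a := by
        rw [MonoidHom.id_apply, Algebra.smul_def, Algebra.smul_def,
          ← smul_eq_mul (algebraMap k A r) (g _), ← map_smul]
        exact congrArg g (pushforward_algebra_smul r (show FGModuleCat.of A A from a))
      map_zero' := by rw [map_zero, map_zero]
      map_add' a b := by rw [map_add, map_add]
      map_mul' a b :=
        (congrArg g (pushforward_smul_eq_smul g_smul (X := FGModuleCat.of A A) a b)).trans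
          (map_smul g _ _) }
  emb M := (counitMap adj M).toAddMonoidHom.comp (pushforward t (F.obj M))
  twist_mul_self a := (h.commute _).symm.trans (e_mul_g _)
  emb_smul {M} a x :=
    (congrArg (counitMap adj M) (pushforward_smul_eq_smul g_smul a x)).trans
      (map_smul (counitMap adj M) _ _)
  emb_map {M N} f x :=
    (congrArg (counitMap adj N) (map_pushforward (F.map f) x).symm).trans
      (counitMap_naturality adj f _)
  emb_injective M := counitMap_pushforward_injective ht M
  smul_eq_iff {M} m := by
    refine ⟨fun hm => ?_, ?_⟩
    · obtain ⟨x, hx⟩ := exists_counitMap_pushforward_eq (adj := adj) g (t := t) m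
      exact ⟨x, hx.trans (by rw [g_t, hm])⟩
    · rintro ⟨x, rfl⟩
      exact (h.smul_eq_iff _).2 ⟨_, rfl⟩
  smul_obj x := h.smul_obj x

theorem IsCounitIdempotent.nonempty_cornerTwist [F.Linear k] [IsNoetherianRing A]
    (h : IsCounitIdempotent adj e) (ht : Submodule.span A {t} = ⊤) :
    Nonempty (CornerTwist k F e) := by
  obtain ⟨g, g_t, e_mul_g, g_smul⟩ := h.exists_coordinate ht
  exact ⟨h.cornerTwistOfGenerator ht g g_t e_mul_g g_smul⟩

end Generator

end CornerTwist

section Basic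

open scoped ModuleCat.Algebra
open Module (finrank)

variable {k : Type v} {A : Type u} [Field k] [Ring A] [Algebra k A]

theorem exists_algHom_smul_eq {L : Type*} [AddCommGroup L] [Module k L] [Module A L]
    [IsScalarTower k A L] (hL : finrank k L = 1) :
    ∃ χ : A →ₐ[k] k, ∀ (a : A) (x : L), a • x = χ a • x := by
  have := Module.finite_of_finrank_eq_succ hL
  have bijective := Module.Free.bijective_algebraMap_of_finrank_eq_one
    (R := k) (S := Module.End k L) (by rw [Module.finrank_linearMap, hL])
  let scalar : k ≃ₐ[k] Module.End k L := AlgEquiv.ofBijective (Algebra.ofId k _) bijective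
  refine ⟨(scalar.symm : Module.End k L →ₐ[k] k).comp (Algebra.lsmul k k L), fun a x => ?_⟩
  exact (congrArg (· x) (scalar.apply_symm_apply (Algebra.lsmul k k L a))).symm

theorem exists_forall_algHom_apply_eq [FiniteDimensional k A] (c : (A →ₐ[k] k) → k) :
    ∃ a : A, ∀ χ : A →ₐ[k] k, χ a = c χ := by
  let eval : A →ₗ[k] (A →ₐ[k] k) → k := LinearMap.pi AlgHom.toLinearMap
  have independent : LinearIndependent k fun (χ : A →ₐ[k] k) (a : A) => χ a :=
    (linearIndependent_monoidHom A k).comp (fun χ : A →ₐ[k] k => (χ : A →* k))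
      fun _ _ h => AlgHom.ext (DFunLike.congr_fun h :)
  have range_eval : LinearMap.range eval = ⊤ := by
    rw [← span_flip_eq_top_iff_linearIndependent.2 independent]
    exact (Submodule.span_eq (LinearMap.range eval)).symm
  obtain ⟨a, ha⟩ := LinearMap.range_eq_top.1 range_eval c
  exact ⟨a, congrFun ha⟩

section Cyclic

variable {P : Type u} [AddCommGroup P] [Module k P] [Module A P] [IsScalarTower k A P]

theorem eq_of_forall_smul_eq {N N' : Submodule A P} (hN : finrank k (P ⧸ N) = 1)
    (hN' : finrank k (P ⧸ N') = 1) {χ : A → k} (smul_eq : ∀ a (x : P ⧸ N), a • x = χ a • x)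
    (smul_eq' : ∀ a (x : P ⧸ N'), a • x = χ a • x) (coatom : IsCoatom N) (coatom' : IsCoatom N')
    (proportional : ∀ f : P →ₗ[A] P ⧸ N, ∃ c : k, ∀ x, f x = c • N.mkQ x) : N = N' := by
  have := Module.finite_of_finrank_eq_succ hN
  have := Module.finite_of_finrank_eq_succ hN'
  let g : (P ⧸ N') ≃ₗ[k] P ⧸ N := LinearEquiv.ofFinrankEq _ _ (hN'.trans hN.symm)
  let f : (P ⧸ N') →ₗ[A] P ⧸ N :=
    { toFun := g
      map_add' := map_add g
      map_smul' := fun a x => by rw [smul_eq', map_smul, RingHom.id_apply, smul_eq] }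
  obtain ⟨c, hc⟩ := proportional (f ∘ₗ N'.mkQ)
  have le : N ≤ N' := by
    intro x hx
    have mkQ_x : N.mkQ x = 0 := (Submodule.Quotient.mk_eq_zero N).2 hx
    have g_x : g (N'.mkQ x) = 0 := (hc x).trans (by rw [mkQ_x, smul_zero])
    exact (Submodule.Quotient.mk_eq_zero N').1 ((map_eq_zero_iff g g.injective).1 g_x)
  exact (coatom.le_iff_eq coatom'.1).1 le |>.symm

/- A generator is an element outside all maximal submodules `N`. By hypothesis these are determined
by the characters by which `A` acts on `P ⧸ N`, so there are finitely many of them, and one can use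
elements of `A` with prescribed values of the characters to glue elements `x N ∉ N`. -/
theorem IsBasicAlgebra.exists_span_singleton_eq_top [FiniteDimensional k A] [Module.Finite A P]
    (hA : IsBasicAlgebra k A) (proportional : ∀ N : Submodule A P, IsCoatom N →
      ∀ f : P →ₗ[A] P ⧸ N, ∃ c : k, ∀ x, f x = c • N.mkQ x) :
    ∃ t : P, Submodule.span A {t} = ⊤ := by
  classical
  let S := {N : Submodule A P // IsCoatom N}
  have finrank_eq (N : S) : finrank k (P ⧸ N.1) = 1 :=
    hA _ (isSimpleModule_iff_isCoatom.2 N.2)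
  choose χ hχ using fun N : S => exists_algHom_smul_eq (A := A) (finrank_eq N)
  have χ_injective : Function.Injective χ := fun N N' h =>
    Subtype.ext (eq_of_forall_smul_eq (finrank_eq N) (finrank_eq N') (hχ N) (h ▸ hχ N') N.2 N'.2
      (proportional N.1 N.2))
  have : Finite S := Finite.of_injective χ χ_injective
  have := Fintype.ofFinite S
  choose a ha using fun N : S =>
    exists_forall_algHom_apply_eq (A := A) (Pi.single (χ N) (1 : k))
  choose x hx using fun N : S => SetLike.exists_not_mem_of_ne_top N.1 N.2.1
  have mkQ_sum (N : S) : N.1.mkQ (∑ N', a N' • x N') = N.1.mkQ (x N) := by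
    rw [map_sum, Finset.sum_eq_single N]
    · rw [map_smul, hχ, ha, Pi.single_eq_same, one_smul]
    · intro N' _ hN'
      rw [map_smul, hχ, ha, Pi.single_eq_of_ne (χ_injective.ne hN'.symm), zero_smul]
    · exact fun h => (h (Finset.mem_univ N)).elim
  refine ⟨∑ N, a N • x N, (eq_top_or_exists_le_coatom _).resolve_right ?_⟩
  rintro ⟨N, coatom, le⟩
  apply hx ⟨N, coatom⟩
  rw [← Submodule.Quotient.mk_eq_zero, ← Submodule.mkQ_apply, ← mkQ_sum ⟨N, coatom⟩]
  exact (Submodule.Quotient.mk_eq_zero N).2 (le (Submodule.mem_span_singleton_self _))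

end Cyclic

variable {F : FGModuleCat.{u} A ⥤ FGModuleCat.{u} A} [F.Additive] (adj : F ⊣ F)

include adj in
theorem injective_of_ne_zero [∀ X, Mono (adj.counit.app X)] [IsNoetherianRing A]
    {L V : FGModuleCat.{u} A} [IsSimpleModule A L] {f : F.obj L ⟶ V} (hf : f ≠ 0) :
    Function.Injective f.hom.hom := by
  let g : L ⟶ F.obj V := adj.homAddEquiv L V f
  have g_ne_zero : g.hom.hom ≠ 0 := fun h =>
    (map_ne_zero_iff _ (adj.homAddEquiv L V).injective).2 hf (FGModuleCat.hom_ext h)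
  have : Mono g := ConcreteCategory.mono_of_injective g
    ((LinearMap.injective_or_eq_zero _).resolve_right g_ne_zero)
  have := adj.isRightAdjoint
  have factorization : f = F.map g ≫ adj.counit.app V :=
    ((adj.homEquiv L V).symm_apply_apply f).symm.trans (adj.homEquiv_counit _ _ _)
  have : Mono f := factorization ▸ mono_comp (F.map g) (adj.counit.app V)
  exact injective_of_mono f

include adj in
theorem IsBasicAlgebra.finrank_obj_le_one [∀ X, Mono (adj.counit.app X)] [IsNoetherianRing A]
    (hA : IsBasicAlgebra k A) (L : FGModuleCat.{u} A) [IsSimpleModule A L] :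
    finrank k (F.obj L) ≤ 1 := by
  cases subsingleton_or_nontrivial (F.obj L) with
  | inl _ => exact Module.finrank_zero_of_subsingleton.trans_le zero_le_one
  | inr _ =>
    refine (hA (F.obj L) (isSimpleModule_iff _ _ |>.2 { eq_bot_or_eq_top := fun U => ?_ })).le
    refine or_iff_not_imp_right.2 fun hU => ?_
    let f : F.obj L ⟶ FGModuleCat.of A (F.obj L ⧸ U) := FGModuleCat.ofHom U.mkQ
    have f_ne_zero : f ≠ 0 := fun h =>
      hU (U.ker_mkQ ▸ LinearMap.ker_eq_top.2 (congrArg (fun g => g.hom.hom) h))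
    rw [← U.ker_mkQ]
    exact LinearMap.ker_eq_bot.2 (injective_of_ne_zero adj f_ne_zero)

include adj in
theorem exists_eq_smul_of_finrank_obj_le_one [F.Linear k] {L : FGModuleCat.{u} A}
    [FiniteDimensional k (F.obj L)] (hL : finrank k (F.obj L) ≤ 1)
    {f : F.obj (FGModuleCat.of A A) ⟶ L} (hf : f ≠ 0) (f' : F.obj (FGModuleCat.of A A) ⟶ L) :
    ∃ c : k, f' = c • f := by
  let g := adj.homAddEquiv _ _ f
  have g_one_ne_zero : g.hom.hom (1 : A) ≠ 0 := fun h => by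
    have g_eq_zero : g = 0 := by
      rw [← evalHom_one g, h, ← evalHom_one (0 : FGModuleCat.of A A ⟶ F.obj L)]
      rfl
    exact (map_ne_zero_iff _ (adj.homAddEquiv _ _).injective).2 hf g_eq_zero
  have finrank_eq : finrank k (F.obj L) = 1 :=
    hL.antisymm (Module.finrank_pos_iff_exists_ne_zero.2 ⟨_, g_one_ne_zero⟩)
  obtain ⟨c, hc⟩ := exists_smul_eq_of_finrank_eq_one finrank_eq g_one_ne_zero
    ((adj.homEquiv _ _ f').hom.hom (1 : A))
  refine ⟨c, (adj.homEquiv _ _).injective ?_⟩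
  calc adj.homEquiv _ _ f' = c • g := by
        rw [← evalHom_one (adj.homEquiv _ _ f'), ← hc, evalHom_algebra_smul, evalHom_one]
    _ = adj.homEquiv _ _ (c • f) := by
        rw [adj.homEquiv_unit, F.map_smul, Linear.comp_smul, ← adj.homEquiv_unit]
        rfl

include adj in
theorem IsBasicAlgebra.exists_span_obj_eq_top [F.Linear k] [FiniteDimensional k A]
    [∀ X, Mono (adj.counit.app X)] (hA : IsBasicAlgebra k A) :
    ∃ t : F.obj (FGModuleCat.of A A), Submodule.span A {t} = ⊤ := by
  have : IsNoetherianRing A := isNoetherian_of_tower k inferInstance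
  refine hA.exists_span_singleton_eq_top fun N coatom f => ?_
  let L := FGModuleCat.of A (F.obj (FGModuleCat.of A A) ⧸ N)
  have : IsSimpleModule A L := isSimpleModule_iff_isCoatom.2 coatom
  have : FiniteDimensional k (F.obj L) := Module.Finite.trans A (F.obj L)
  have mkQ_ne_zero : (FGModuleCat.ofHom N.mkQ : F.obj (FGModuleCat.of A A) ⟶ L) ≠ 0 := fun h =>
    coatom.1 (N.ker_mkQ ▸ LinearMap.ker_eq_top.2 (congrArg (fun g => g.hom.hom) h))
  obtain ⟨c, hc⟩ := exists_eq_smul_of_finrank_obj_le_one adj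
    (hA.finrank_obj_le_one adj L) mkQ_ne_zero (FGModuleCat.ofHom f)
  exact ⟨c, fun x => congrArg (fun g => g.hom.hom x) hc⟩

end Basic

section CornerRing

variable {k : Type v} {A : Type u} [Field k] [Ring A] [Algebra k A] {e : A}

instance (he : IsIdempotentElem e) : SMul k he.Corner where
  smul r x := ⟨r • x.1, by
    obtain ⟨a, ha⟩ := x.2
    exact ⟨r • a, (congrArg (· * e) (mul_smul_comm r e a)).trans
      ((smul_mul_assoc r (e * a) e).trans (congrArg (r • ·) ha))⟩⟩

instance (he : IsIdempotentElem e) : Module k he.Corner :=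
  Function.Injective.module k
    { toFun := Subtype.val, map_zero' := rfl, map_add' := fun _ _ => rfl : he.Corner →+ A }
    Subtype.val_injective fun _ _ => rfl

instance (he : IsIdempotentElem e) : Algebra k he.Corner :=
  Algebra.ofModule (fun _ _ _ => Subtype.ext (smul_mul_assoc _ _ _))
    fun _ _ _ => Subtype.ext (mul_smul_comm _ _ _)

variable (k) in
/-- The projection `a ↦ a e` onto the corner of a central idempotent `e`. -/
def toCorner (he : IsIdempotentElem e) (hc : ∀ a, Commute e a) : A →ₐ[k] he.Corner :=
  .ofLinearMap
    { toFun a := ⟨a * e, (Subsemigroup.mem_corner_iff he).2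
        ⟨by rw [(hc _).eq, mul_assoc, he], by rw [mul_assoc, he]⟩⟩
      map_add' a b := Subtype.ext (add_mul a b e)
      map_smul' r a := Subtype.ext (smul_mul_assoc r a e) }
    (Subtype.ext (one_mul e))
    fun a b => Subtype.ext <|
      calc a * b * e = a * (b * (e * e)) := by rw [he, mul_assoc]
        _ = a * e * (b * e) := by rw [← mul_assoc b, ← (hc (b * e)).eq, mul_assoc]

theorem toCorner_self (he : IsIdempotentElem e) (hc : ∀ a, Commute e a) : toCorner k he hc e = 1 :=
  Subtype.ext he

theorem toCorner_coe (he : IsIdempotentElem e) (hc : ∀ a, Commute e a) (b : he.Corner) :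
    toCorner k he hc b.1 = b :=
  Subtype.ext ((Subsemigroup.mem_corner_iff he).1 b.2).2

variable (k) in
/-- The Peirce decomposition of `A` along a central idempotent. -/
def cornerProdEquiv (he : IsIdempotentElem e) (hc : ∀ a, Commute e a) :
    A ≃ₐ[k] he.Corner × he.one_sub.Corner :=
  have hc' (a : A) : Commute (1 - e) a := (Commute.one_left a).sub_left (hc a)
  { (toCorner k he hc).prod (toCorner k he.one_sub hc') with
    invFun x := x.1.1 + x.2.1
    left_inv a := by
      change a * e + a * (1 - e) = a
      rw [← mul_add, add_sub_cancel, mul_one]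
    right_inv x := by
      have fst_mul : x.1.1 * e = x.1.1 := ((Subsemigroup.mem_corner_iff he).1 x.1.2).2
      have snd_mul : x.2.1 * (1 - e) = x.2.1 :=
        ((Subsemigroup.mem_corner_iff he.one_sub).1 x.2.2).2
      refine Prod.ext (Subtype.ext ?_) (Subtype.ext ?_)
      · change (x.1.1 + x.2.1) * e = x.1.1
        rw [add_mul, fst_mul, ← snd_mul, mul_assoc, he.one_sub_mul_self, mul_zero, add_zero]
      · change (x.1.1 + x.2.1) * (1 - e) = x.2.1
        rw [add_mul, snd_mul, ← fst_mul, mul_assoc, he.mul_one_sub_self, mul_zero, zero_add] }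

theorem cornerProdEquiv_self (he : IsIdempotentElem e) (hc : ∀ a, Commute e a) :
    cornerProdEquiv k he hc e = (1, 0) :=
  Prod.ext (toCorner_self he hc) (Subtype.ext he.mul_one_sub_self)

/-- The algebra endomorphism of the corner of `e` given by the twist. -/
def CornerTwist.cornerHom {F : FGModuleCat.{u} A ⥤ FGModuleCat.{u} A} (D : CornerTwist k F e) :
    D.isIdempotentElem.Corner →ₐ[k] D.isIdempotentElem.Corner :=
  .ofLinearMap
    { toFun b := ⟨D.twist b.1, (Subsemigroup.mem_corner_iff D.isIdempotentElem).2
        ⟨(D.commute _).trans (D.twist_mul_self _), D.twist_mul_self _⟩⟩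
      map_add' b c := Subtype.ext (map_add D.twist b.1 c.1)
      map_smul' r b := Subtype.ext (map_smul D.twist r b.1) }
    (Subtype.ext D.twist_self)
    fun b c => Subtype.ext (map_mul D.twist b.1 c.1)

theorem CornerTwist.cornerHom_toCorner {F : FGModuleCat.{u} A ⥤ FGModuleCat.{u} A}
    (D : CornerTwist k F e) (a : A) :
    D.cornerHom (toCorner k D.isIdempotentElem D.commute a) =
      toCorner k D.isIdempotentElem D.commute (D.twist a) :=
  Subtype.ext ((D.twist_mul a).trans (D.twist_mul_self a).symm)

end CornerRing

/- Applying the hypothesis to `t` shows that `φ (φ t)` is a left inverse of `s`, so that `φ²` is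
conjugation by the unit `s`, hence bijective. -/
theorem exists_algEquiv_isInnerAut {k : Type v} [Field k] {B : Type u} [Ring B] [Algebra k B]
    (φ : B →ₐ[k] B) {s t : B} (hst : s * t = 1) (hs : ∀ b, s * b = φ (φ b) * s) :
    ∃ φ' : B ≃ₐ[k] B, (∀ b, φ' b = φ b) ∧ IsInnerAut (φ' * φ') := by
  have left_inverse : φ (φ t) * s = 1 := by rw [← hs, hst]
  have hts : t * s = 1 := left_inv_eq_right_inv left_inverse hst ▸ left_inverse
  have conjugation (b : B) : φ (φ b) = s * b * t := by rw [hs, mul_assoc, hst, mul_one]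
  have bijective : Function.Bijective φ := by
    refine ⟨(injective_iff_map_eq_zero φ).2 fun b hb => ?_, fun b => ⟨φ (t * b * s), ?_⟩⟩
    · calc b = t * (s * b * t) * s := by
            rw [mul_assoc s, ← mul_assoc t, hts, one_mul, mul_assoc, hts, mul_one]
        _ = 0 := by rw [← conjugation, hb, map_zero, mul_zero, zero_mul]
    · calc φ (φ (t * b * s)) = s * (t * b * s) * t := conjugation _
        _ = b := by rw [mul_assoc t, ← mul_assoc s, hst, one_mul, mul_assoc, hst, mul_one]
  exact ⟨.ofBijective φ bijective, fun b => rfl, ⟨s, t, hst, hts⟩, conjugation⟩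

theorem CornerTwist.exists_algEquiv_isInnerAut {k : Type v} {A : Type u} [Field k] [Ring A]
    [Algebra k A] {F : FGModuleCat.{u} A ⥤ FGModuleCat.{u} A} {e : A} {adj : F ⊣ F}
    (D : CornerTwist k F e) (h : IsCounitIdempotent adj e) :
    ∃ φ : D.isIdempotentElem.Corner ≃ₐ[k] D.isIdempotentElem.Corner,
      (∀ a, φ (toCorner k D.isIdempotentElem D.commute a) =
        toCorner k D.isIdempotentElem D.commute (D.twist a)) ∧ IsInnerAut (φ * φ) := by
  obtain ⟨s, s', hss', hs⟩ := h.exists_mul_eq_twist_twist_mul D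
  let p := toCorner k D.isIdempotentElem D.commute
  have p_e : p e = 1 := toCorner_self _ _
  obtain ⟨φ, hφ, inner⟩ := SelfadjointFunctors.exists_algEquiv_isInnerAut D.cornerHom
    (s := p s) (t := p s') (by rw [← map_mul, hss', p_e]) fun b => by
      have p_b : p b.1 = b := toCorner_coe _ _ b
      rw [← p_b, D.cornerHom_toCorner, D.cornerHom_toCorner, ← map_mul, ← map_mul, ← hs, map_mul,
        map_mul, map_mul, p_e, mul_one]
  exact ⟨φ, fun a => (hφ _).trans (D.cornerHom_toCorner a), inner⟩

section TwistedTensor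

variable {k : Type v} [Field k] {B : Type u} [Ring B] [Algebra k B] (φ : B ≃ₐ[k] B)
  (N : Type u) [AddCommGroup N] [Module B N]

/-- The map `n ↦ 1 ⊗ n`. -/
def oneTensor : N →+ BalancedTensor B B (TwistedBimodule φ) N :=
  (balancedRelations B B (TwistedBimodule φ) N).mkQ.toAddMonoidHom.comp
    (TensorProduct.mk ℤ (TwistedBimodule φ) N (1 : B)).toAddMonoidHom

/-- The action `x ⊗ n ↦ x n`, inverse to `oneTensor`. -/
def untwist : BalancedTensor B B (TwistedBimodule φ) N →ₛₗ[(φ : B →+* B)] N :=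
  let action : TwistedBimodule φ ⊗[ℤ] N →+ N := TensorProduct.liftAddHom
    (Module.toAddMonoidEnd B N).toAddMonoidHom
    fun z x n => (smul_assoc z (show B from x) n).trans (smul_comm z (show B from x) n)
  let action' : TwistedBimodule φ ⊗[ℤ] N →ₛₗ[(φ : B →+* B)] N :=
    { action with
      map_smul' b y := by
        change action (b • y) = φ b • action y
        induction y using TensorProduct.induction_on with
        | zero => rw [smul_zero, map_zero, smul_zero]
        | tmul x n => exact mul_smul (φ b) (show B from x) n
        | add x y hx hy => rw [smul_add, map_add, hx, hy, map_add, smul_add] }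
  (balancedRelations B B (TwistedBimodule φ) N).liftQ action' <| Submodule.span_le.2 <| by
    rintro _ ⟨x, r, n, rfl⟩
    exact LinearMap.sub_mem_ker_iff.2 (mul_smul (show B from x) r n)

variable {N}

theorem mkQ_tmul_eq_oneTensor (x : B) (n : N) :
    (balancedRelations B B (TwistedBimodule φ) N).mkQ
      ((show TwistedBimodule φ from x) ⊗ₜ[ℤ] n) = oneTensor φ N (x • n) := by
  have one_smul_op : MulOpposite.op x • (show TwistedBimodule φ from (1 : B)) =
    (show TwistedBimodule φ from x) := one_mul x
  conv_lhs => rw [← one_smul_op]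
  exact (Submodule.Quotient.eq _).2 (Submodule.subset_span ⟨_, x, n, rfl⟩)

theorem smul_oneTensor (b : B) (n : N) : b • oneTensor φ N n = oneTensor φ N (φ b • n) := by
  have smul_one : b • (show TwistedBimodule φ from (1 : B)) = (show TwistedBimodule φ from φ b) :=
    mul_one (φ b)
  rw [← mkQ_tmul_eq_oneTensor, ← smul_one, ← TensorProduct.smul_tmul', map_smul]
  rfl

theorem oneTensor_bijective : Function.Bijective (oneTensor φ N) := by
  constructor
  · exact Function.LeftInverse.injective (g := untwist φ N) fun n => one_smul B n
  · intro y
    obtain ⟨t, rfl⟩ := (balancedRelations B B (TwistedBimodule φ) N).mkQ_surjective y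
    induction t using TensorProduct.induction_on with
    | zero => exact ⟨0, by rw [map_zero, map_zero]⟩
    | tmul x n => exact ⟨(show B from x) • n, (mkQ_tmul_eq_oneTensor φ x n).symm⟩
    | add x y hx hy =>
      obtain ⟨m, hm⟩ := hx
      obtain ⟨n, hn⟩ := hy
      exact ⟨m + n, by rw [map_add, map_add, hm, hn]⟩

end TwistedTensor

section Comparison

variable {k : Type v} {A : Type u} [Field k] [Ring A] [Algebra k A]
  {F : FGModuleCat.{u} A ⥤ FGModuleCat.{u} A} {e : A} (D : CornerTwist k F e)
  {B C : Type u} [Ring B] [Ring C] [Algebra k B] [Algebra k C] {E : A ≃ₐ[k] B × C}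
  {φ : B ≃ₐ[k] B}

variable (E) in
/-- The `B`-component of an `A`-module, for an isomorphism `E` of `A` with `B × C`. -/
abbrev prodFstPart (M : FGModuleCat.{u} A) :=
  FstPart (B := B) (C := C) ((restrictFG ((E : A ≃+* B × C).symm : B × C →+* A)
    (E : A ≃+* B × C).symm.surjective).obj M)

namespace CornerTwist

/-- The embedding of `F M` in `M`, with its image as codomain. -/
def embFstPart (hE : E e = (1, 0)) (M : FGModuleCat.{u} A) : F.obj M →+ prodFstPart E M :=
  (D.emb M).codRestrict (prodFstPart E M) fun x => by
    change E.symm (1, 0) • D.emb M x = D.emb M x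
    rw [← hE, AlgEquiv.symm_apply_apply, D.smul_emb]

theorem embFstPart_bijective (hE : E e = (1, 0)) (M : FGModuleCat.{u} A) :
    Function.Bijective (D.embFstPart hE M) := by
  refine ⟨fun x y hxy => D.emb_injective M (congrArg Subtype.val hxy), fun m => ?_⟩
  have smul_m : E.symm (1, 0) • (show M from m.1) = m.1 := m.2
  rw [← hE, AlgEquiv.symm_apply_apply] at smul_m
  obtain ⟨x, hx⟩ := (D.smul_eq_iff _).1 smul_m
  exact ⟨x, Subtype.ext hx⟩

theorem embFstPart_smul (hE : E e = (1, 0)) {M : FGModuleCat.{u} A} (a : A) (x : F.obj M) :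
    D.embFstPart hE M (a • x) = (E (D.twist a)).1 • D.embFstPart hE M x := by
  apply Subtype.ext
  change D.emb M (a • x) = E.symm ((E (D.twist a)).1, 0) • D.emb M x
  have E_twist : ((E (D.twist a)).1, (0 : C)) = E (D.twist a) := by
    conv_rhs => rw [← D.twist_mul_self, map_mul, hE]
    exact Prod.ext (mul_one _).symm (mul_zero _).symm
  rw [D.emb_smul, E_twist, AlgEquiv.symm_apply_apply]

/-- The map from `F M` to the tensor product of the twisted bimodule `B` with the `B`-component
of `M`. -/
def toTransport (hE : E e = (1, 0)) (hφ : ∀ a, φ (E a).1 = (E (D.twist a)).1)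
    (M : FGModuleCat.{u} A) :
    F.obj M →ₗ[A] (transportFunctor (E : A ≃+* B × C)
      (externalSum (twistFunctor φ) (zeroFunctor C))).obj M where
  toFun x := ((oneTensor φ (prodFstPart E M) (D.embFstPart hE M x), PUnit.unit) :
    BalancedTensor B B (TwistedBimodule φ) (prodFstPart E M) × PUnit)
  map_add' x y := Prod.ext
    (map_add ((oneTensor φ (prodFstPart E M)).comp (D.embFstPart hE M)) x y) rfl
  map_smul' a x := by
    refine Prod.ext ?_ rfl
    change oneTensor φ _ (D.embFstPart hE M (a • x)) =
      (E a).1 • oneTensor φ _ (D.embFstPart hE M x)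
    rw [smul_oneTensor, hφ, D.embFstPart_smul]

theorem toTransport_bijective (hE : E e = (1, 0)) (hφ : ∀ a, φ (E a).1 = (E (D.twist a)).1)
    (M : FGModuleCat.{u} A) : Function.Bijective (D.toTransport hE hφ M) := by
  have bijective := (oneTensor_bijective φ).comp (D.embFstPart_bijective hE M)
  refine ⟨fun x y hxy => bijective.1 (congrArg Prod.fst hxy), fun y => ?_⟩
  obtain ⟨x, hx⟩ := bijective.2 y.1
  exact ⟨x, Prod.ext hx rfl⟩

/-- The description of `F` as a twist on the direct factor `B` of `A`. -/
def isoTransport (hE : E e = (1, 0)) (hφ : ∀ a, φ (E a).1 = (E (D.twist a)).1) :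
    F ≅ transportFunctor (E : A ≃+* B × C)
      (externalSum (twistFunctor φ) (zeroFunctor C)) :=
  NatIso.ofComponents
    (fun M => (LinearEquiv.ofBijective _ (D.toTransport_bijective hE hφ M)).toFGModuleCatIso)
    fun {_ N} f => FGModuleCat.hom_ext <| LinearMap.ext fun x => by
      refine Prod.ext ?_ rfl
      exact congrArg (oneTensor φ (prodFstPart E N)) (Subtype.ext (D.emb_map f x))

end CornerTwist

end Comparison

theorem IsBasicAlgebra.exists_iso_transportFunctor {k : Type v} {A : Type u} [Field k] [Ring A]
    [Algebra k A] [FiniteDimensional k A] (hA : IsBasicAlgebra k A)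
    {F : FGModuleCat.{u} A ⥤ FGModuleCat.{u} A} [F.Additive] [F.Linear k] (adj : F ⊣ F)
    [∀ X, IsIso (adj.counit.app (F.obj X))] :
    ∃ (B C : Type u) (_ : Ring B) (_ : Ring C) (_ : Algebra k B) (_ : Algebra k C)
      (e : A ≃ₐ[k] B × C) (φ : B ≃ₐ[k] B), IsInnerAut (φ * φ) ∧
      Nonempty (F ≅ transportFunctor (e : A ≃+* B × C)
        (externalSum (twistFunctor φ) (zeroFunctor C))) := by
  have : IsNoetherianRing A := isNoetherian_of_tower k inferInstance
  have := isSplitMono_counit adj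
  obtain ⟨e, he⟩ := exists_isCounitIdempotent adj
  obtain ⟨t, ht⟩ := hA.exists_span_obj_eq_top adj
  obtain ⟨D⟩ := he.nonempty_cornerTwist (k := k) ht
  obtain ⟨φ, hφ, inner⟩ := D.exists_algEquiv_isInnerAut he
  exact ⟨_, _, inferInstance, inferInstance, inferInstance, inferInstance,
    cornerProdEquiv k D.isIdempotentElem D.commute, φ, inner,
    ⟨D.isoTransport (cornerProdEquiv_self _ _) hφ⟩⟩

end SelfadjointFunctors

end

theorem mainTheorem3_general (𝕜 : Type v) (A : Type u) [Field 𝕜] [Ring A] [Algebra 𝕜 A]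
    [FiniteDimensional 𝕜 A] (hA : SelfadjointFunctors.IsBasicAlgebra 𝕜 A) (k m : ℕ) (hk : m < k) :
    (∀ (F : FGModuleCat.{u} A ⥤ FGModuleCat.{u} A) [F.Additive] [F.Linear 𝕜],
      SelfadjointFunctors.IsSelfadjointFunctor F →
      Nonempty (SelfadjointFunctors.functorPow F k ≅ SelfadjointFunctors.functorPow F m) →
      (Odd (k - m) → Nonempty (SelfadjointFunctors.functorPow F 2 ≅ F)) ∧
      ∃ (B C : Type u) (_ : Ring B) (_ : Ring C) (_ : Algebra 𝕜 B) (_ : Algebra 𝕜 C)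
        (e : A ≃ₐ[𝕜] B × C) (φ : B ≃ₐ[𝕜] B),
        SelfadjointFunctors.IsInnerAut (φ * φ) ∧
        Nonempty (F ≅ SelfadjointFunctors.transportFunctor (e : A ≃+* B × C)
          (SelfadjointFunctors.externalSum (SelfadjointFunctors.twistFunctor φ)
            (SelfadjointFunctors.zeroFunctor C)))) ∧
    (1 ≤ m → ∀ F : FGModuleCat.{u} A ⥤ FGModuleCat.{u} A,
      Nonempty (SelfadjointFunctors.functorPow F 2 ≅ F) →
      Nonempty (SelfadjointFunctors.functorPow F k ≅ SelfadjointFunctors.functorPow F m)) := by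
  refine ⟨fun F _ _ ⟨adj⟩ hF => ?_, fun hm F h => ?_⟩
  · have : IsNoetherianRing A := isNoetherian_of_tower 𝕜 inferInstance
    rw [← Nat.add_sub_cancel' hk.le] at hF
    have := SelfadjointFunctors.isIso_counit_app_obj adj (Nat.sub_pos_of_lt hk) hF
    exact ⟨fun hodd => SelfadjointFunctors.functorPow_two_iso_of_odd
      (SelfadjointFunctors.functorPow_three_iso adj) hodd hF, hA.exists_iso_transportFunctor adj⟩
  · obtain ⟨α⟩ := SelfadjointFunctors.functorPow_iso_of_idempotent h (hm.trans hk.le)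
    obtain ⟨β⟩ := SelfadjointFunctors.functorPow_iso_of_idempotent h hm
    exact ⟨α ≪≫ β.symm⟩

theorem mainTheorem3 (𝕜 : Type v) (A : Type u) [Field 𝕜] [IsAlgClosed 𝕜] [Ring A]
    [Algebra 𝕜 A] [FiniteDimensional 𝕜 A] (hA : SelfadjointFunctors.IsBasicAlgebra 𝕜 A)
    (k m : ℕ) (hm : 1 ≤ m) (hk : m < k) :
    (∀ (F : FGModuleCat.{u} A ⥤ FGModuleCat.{u} A) [F.Additive] [F.Linear 𝕜],
      SelfadjointFunctors.IsSelfadjointFunctor F →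
      Nonempty (SelfadjointFunctors.functorPow F k ≅ SelfadjointFunctors.functorPow F m) →
      (Odd (k - m) → Nonempty (SelfadjointFunctors.functorPow F 2 ≅ F)) ∧
      (Even (k - m) →
        ∃ (B C : Type u) (_ : Ring B) (_ : Ring C) (_ : Algebra 𝕜 B) (_ : Algebra 𝕜 C)
          (e : A ≃ₐ[𝕜] B × C) (φ : B ≃ₐ[𝕜] B),
          SelfadjointFunctors.IsInnerAut (φ * φ) ∧
          Nonempty (F ≅ SelfadjointFunctors.transportFunctor (e : A ≃+* B × C)
            (SelfadjointFunctors.externalSum (SelfadjointFunctors.twistFunctor φ)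
              (SelfadjointFunctors.zeroFunctor C))))) ∧
    (∀ (F : FGModuleCat.{u} A ⥤ FGModuleCat.{u} A),
      Nonempty (SelfadjointFunctors.functorPow F 2 ≅ F) →
      Nonempty (SelfadjointFunctors.functorPow F k ≅ SelfadjointFunctors.functorPow F m)) := by
  obtain ⟨selfadjoint, idempotent⟩ := mainTheorem3_general 𝕜 A hA k m hk
  exact ⟨fun F _ _ adj hF => (selfadjoint F adj hF).imp_right fun h _ => h, idempotent hm⟩
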